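/- Let $d\ge 1$ be an integer and $u\in\mathbb{C}\setminus\{0,1\}$. The Yokonuma–Hecke algebra ${\rm Y}_{d,n}={\rm Y}_{d,n}(u)$ is the $\mathbb{C}$-algebra generated by $t_1,\dots,t_n,g_1,\dots,g_{n-1}$ with the relations $g_ig_j=g_jg_i$ for $|i-j|>1$, $g_ig_{i+1}g_i=g_{i+1}g_ig_{i+1}$, $t_jt_k=t_kt_j$, $t_j^d=1$, $g_it_i=t_{i+1}g_i$, $g_it_{i+1}=t_ig_i$, $g_it_j=t_jg_i$ for $j\ne i,i+1$, and $g_i^2=1+(u-1)e_i+(u-1)e_ig_i$, where $e_i=\frac1d\sum_{m=0}^{d-1}t_i^mt_{i+1}^{-m}$. The algebra ${\rm YTL}_{d,n}$ is the quotient of ${\rm Y}_{d,n}$ by the two-sided ideal generated by the elements $L_i=g_ig_{i+1}g_i+g_ig_{i+1}+g_{i+1}g_i+g_i+g_{i+1}+1$, $1\le i\le n-2$. Let ${\rm Y}_{d,\infty}$ and ${\rm YTL}_{d,\infty}$ be the inductive limits over $n$. For $z,x_1,\dots,x_{d-1}\in\mathbb{C}$ let ${\rm tr}:{\rm Y}_{d,\infty}\to\mathbb{C}$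 be the Juyumaya trace with these parameters, that is, the linear functional with ${\rm tr}(ab)={\rm tr}(ba)$, ${\rm tr}(1)=1$, ${\rm tr}(ag_nb)=z\,{\rm tr}(ab)$ for $n\ge 1$ and $a,b\in{\rm Y}_{d,n}$, and ${\rm tr}(at_{n+1}^s)=x_s{\rm tr}(a)$ for $n\ge 0$, $a\in{\rm Y}_{d,n}$, $1\le s\le d-1$. Put $x_0=1$, read indices modulo $d$, and let ${\rm E}_d=\frac1d\sum_{m=0}^{d-1}x_mx_{-m}$. (1) For all $z,x_1,\dots,x_{d-1}$ one has ${\rm tr}(e_i)={\rm E}_d$ for all $i\ge1$, and for every $i\ge 1$ the trace respects the linear relation on $g_ig_{i+1}g_i$, i.e. ${\rm tr}(L_i)=0$, if and only if $$(u+1)z^2+\big((u-1){\rm E}_d+3\big)z+1=0;$$ for $u\ne-1$ this means that $z$ is one of $$z_{1,2}=\frac{-u{\rm E}_d\pm\sqrt{(u{\rm E}_d-{\rm E}_d+3)^2-4(u+1)}+{\rm E}_d-3}{2(u+1)}.$$ If ${\rm tr}$ factors through the quotient map ${\rm Y}_{d,\infty}\to{\rm YTL}_{d,\infty}$, then $z$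 satisfies this equation. (2) Let $d\ge2$. For generic $x_1,\dots,x_{d-1}$ the Juyumaya trace does not pass through to the quotient, whatever $z$ is. More precisely, there is a nonzero polynomial $P\in\mathbb{C}[X_1,\dots,X_{d-1}]$, depending only on $d$ and $u$, such that for all $x_1,\dots,x_{d-1}\in\mathbb{C}$ with $P(x_1,\dots,x_{d-1})\neq0$ and all $z\in\mathbb{C}$: ${\rm tr}$ does not factor through ${\rm YTL}_{d,\infty}$; for every $n\ge3$ the restriction of ${\rm tr}$ to ${\rm Y}_{d,n}$ does not factor through ${\rm YTL}_{d,n}$; and if $z$ satisfies the equation in (1), then for all integers $k_1,k_2,k\ge0$ that are not all divisible by $d$, with $w=t_1^{k_1}t_2^{k_2}t_3^{k}$, $${\rm tr}(wg_1g_2g_1)\neq{\rm tr}\big(w(-g_1g_2-g_2g_1-g_1-g_2-1)\big).$$ -/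

import Mathlib

noncomputable section

namespace Yokonuma

/-- Generators of the Yokonuma-Hecke algebra on `n` strands:
`t_1, …, t_n` and `g_1, …, g_{n-1}`. -/
inductive Gen (n : ℕ) : Type
  | t (j : ℕ) (h : 1 ≤ j ∧ j ≤ n) : Gen n
  | g (i : ℕ) (h : 1 ≤ i ∧ i < n) : Gen n

/-- `(1/d) ∑_{m=0}^{d-1} a^m b^{-m}`, for elements `a`, `b` with `b^d = 1`
(so that `b^{-m} = b^{d-m}`). -/
def avg {A : Type} [Ring A] [Algebra ℂ A] (d : ℕ) (a b : A) : A :=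
  (1 / (d : ℂ)) • ∑ m ∈ Finset.range d, a ^ m * b ^ (d - m)

/-- The expression `a b a + a b + b a + a + b + 1`. -/
def lin {A : Type} [Ring A] (a b : A) : A :=
  a * b * a + a * b + b * a + a + b + 1

theorem map_avg {A B : Type} [Ring A] [Algebra ℂ A] [Ring B] [Algebra ℂ B] (f : A →ₐ[ℂ] B)
    (d : ℕ) (a b : A) : f (avg d a b) = avg d (f a) (f b) := by
  simp [avg, map_sum]

theorem map_lin {A B : Type} [Ring A] [Algebra ℂ A] [Ring B] [Algebra ℂ B] (f : A →ₐ[ℂ] B)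
    (a b : A) : f (lin a b) = lin (f a) (f b) := by
  simp [lin]

/-- The free generator `t_j`. -/
def tF {n : ℕ} (j : ℕ) (h : 1 ≤ j ∧ j ≤ n) : FreeAlgebra ℂ (Gen n) :=
  FreeAlgebra.ι ℂ (Gen.t j h)

/-- The free generator `g_i`. -/
def gF {n : ℕ} (i : ℕ) (h : 1 ≤ i ∧ i < n) : FreeAlgebra ℂ (Gen n) :=
  FreeAlgebra.ι ℂ (Gen.g i h)

/-- The defining relations of the Yokonuma-Hecke algebra `Y_{d,n}(u)`. -/
inductive YRel (d : ℕ) (u : ℂ) (n : ℕ) :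
    FreeAlgebra ℂ (Gen n) → FreeAlgebra ℂ (Gen n) → Prop
  | far (i j : ℕ) (hi : 1 ≤ i ∧ i < n) (hj : 1 ≤ j ∧ j < n) (hij : i + 1 < j) :
      YRel d u n (gF i hi * gF j hj) (gF j hj * gF i hi)
  | braid (i : ℕ) (hi : 1 ≤ i ∧ i < n) (hi' : 1 ≤ i + 1 ∧ i + 1 < n) :
      YRel d u n (gF i hi * gF (i + 1) hi' * gF i hi)
        (gF (i + 1) hi' * gF i hi * gF (i + 1) hi')
  | comm (j k : ℕ) (hj : 1 ≤ j ∧ j ≤ n) (hk : 1 ≤ k ∧ k ≤ n) :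
      YRel d u n (tF j hj * tF k hk) (tF k hk * tF j hj)
  | modular (j : ℕ) (hj : 1 ≤ j ∧ j ≤ n) :
      YRel d u n (tF j hj ^ d) 1
  | mixed_left (i : ℕ) (hi : 1 ≤ i ∧ i < n) (h : 1 ≤ i ∧ i ≤ n) (h' : 1 ≤ i + 1 ∧ i + 1 ≤ n) :
      YRel d u n (gF i hi * tF i h) (tF (i + 1) h' * gF i hi)
  | mixed_right (i : ℕ) (hi : 1 ≤ i ∧ i < n) (h : 1 ≤ i ∧ i ≤ n) (h' : 1 ≤ i + 1 ∧ i + 1 ≤ n) :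
      YRel d u n (gF i hi * tF (i + 1) h') (tF i h * gF i hi)
  | mixed_far (i j : ℕ) (hi : 1 ≤ i ∧ i < n) (hj : 1 ≤ j ∧ j ≤ n) (h : j ≠ i) (h' : j ≠ i + 1) :
      YRel d u n (gF i hi * tF j hj) (tF j hj * gF i hi)
  | quadratic (i : ℕ) (hi : 1 ≤ i ∧ i < n) (h : 1 ≤ i ∧ i ≤ n) (h' : 1 ≤ i + 1 ∧ i + 1 ≤ n) :
      YRel d u n (gF i hi ^ 2)
        (1 + (u - 1) • avg d (tF i h) (tF (i + 1) h')
          + (u - 1) • (avg d (tF i h) (tF (i + 1) h') * gF i hi))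

/-- The Yokonuma-Hecke algebra `Y_{d,n}(u)`. -/
def Y (d : ℕ) (u : ℂ) (n : ℕ) : Type := RingQuot (YRel d u n)

instance (d : ℕ) (u : ℂ) (n : ℕ) : Ring (Y d u n) :=
  inferInstanceAs (Ring (RingQuot (YRel d u n)))

instance (d : ℕ) (u : ℂ) (n : ℕ) : Algebra ℂ (Y d u n) :=
  inferInstanceAs (Algebra ℂ (RingQuot (YRel d u n)))

/-- The quotient map from the free algebra onto `Y_{d,n}(u)`. -/
def Y.mk (d : ℕ) (u : ℂ) (n : ℕ) : FreeAlgebra ℂ (Gen n) →ₐ[ℂ] Y d u n :=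
  RingQuot.mkAlgHom ℂ (YRel d u n)

theorem Y.mk_rel {d : ℕ} {u : ℂ} {n : ℕ} {a b : FreeAlgebra ℂ (Gen n)} (h : YRel d u n a b) :
    Y.mk d u n a = Y.mk d u n b :=
  RingQuot.mkAlgHom_rel ℂ h

/-- The element `t_j` of `Y_{d,n}(u)`, `1 ≤ j ≤ n`. -/
def Y.t (d : ℕ) (u : ℂ) (n j : ℕ) (h : 1 ≤ j ∧ j ≤ n := by omega) : Y d u n :=
  Y.mk d u n (tF j h)

/-- The element `g_i` of `Y_{d,n}(u)`, `1 ≤ i ≤ n - 1`. -/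
def Y.g (d : ℕ) (u : ℂ) (n i : ℕ) (h : 1 ≤ i ∧ i < n := by omega) : Y d u n :=
  Y.mk d u n (gF i h)

/-- The images in `Y_{d,m}(u)` of the generators on `n ≤ m` strands. -/
def Y.genMap (d : ℕ) (u : ℂ) {n m : ℕ} (hnm : n ≤ m) : Gen n → Y d u m
  | Gen.t j h => Y.t d u m j ⟨h.1, h.2.trans hnm⟩
  | Gen.g i h => Y.g d u m i ⟨h.1, h.2.trans_le hnm⟩

theorem Y.genMap_rel (d : ℕ) (u : ℂ) {n m : ℕ} (hnm : n ≤ m) ⦃a b : FreeAlgebra ℂ (Gen n)⦄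
    (h : YRel d u n a b) :
    FreeAlgebra.lift ℂ (Y.genMap d u hnm) a = FreeAlgebra.lift ℂ (Y.genMap d u hnm) b := by
  have ht : ∀ (j : ℕ) (h : 1 ≤ j ∧ j ≤ n), FreeAlgebra.lift ℂ (Y.genMap d u hnm) (tF j h) =
      Y.mk d u m (tF j ⟨h.1, h.2.trans hnm⟩) := fun j h => by
    simp [tF, Y.genMap, Y.t]
  have hg : ∀ (i : ℕ) (h : 1 ≤ i ∧ i < n), FreeAlgebra.lift ℂ (Y.genMap d u hnm) (gF i h) =
      Y.mk d u m (gF i ⟨h.1, h.2.trans_le hnm⟩) := fun i h => by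
    simp [gF, Y.genMap, Y.g]
  cases h with
  | far i j hi hj hij =>
    simp only [map_mul, hg]
    simpa only [map_mul] using Y.mk_rel (YRel.far (d := d) (u := u) i j _ _ hij)
  | braid i hi hi' =>
    simp only [map_mul, hg]
    simpa only [map_mul] using Y.mk_rel (YRel.braid (d := d) (u := u) i _ _)
  | comm j k hj hk =>
    simp only [map_mul, ht]
    simpa only [map_mul] using Y.mk_rel (YRel.comm (d := d) (u := u) j k _ _)
  | modular j hj =>
    simp only [map_pow, ht, map_one]
    simpa only [map_pow, map_one] using Y.mk_rel (YRel.modular (d := d) (u := u) j _)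
  | mixed_left i hi h h' =>
    simp only [map_mul, hg, ht]
    simpa only [map_mul] using Y.mk_rel (YRel.mixed_left (d := d) (u := u) i _ _ _)
  | mixed_right i hi h h' =>
    simp only [map_mul, hg, ht]
    simpa only [map_mul] using Y.mk_rel (YRel.mixed_right (d := d) (u := u) i _ _ _)
  | mixed_far i j hi hj h h' =>
    simp only [map_mul, hg, ht]
    simpa only [map_mul] using Y.mk_rel (YRel.mixed_far (d := d) (u := u) i j _ _ h h')
  | quadratic i hi h h' =>
    simp only [map_mul, map_pow, map_add, map_one, map_smul, map_avg, hg, ht]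
    simpa only [map_mul, map_pow, map_add, map_one, map_smul, map_avg] using
      Y.mk_rel (YRel.quadratic (d := d) (u := u) i _ _ _)

/-- The natural map `Y_{d,n}(u) → Y_{d,m}(u)` for `n ≤ m`, which sends `t_j` to `t_j` and `g_i` to
`g_i`. -/
def Y.incl (d : ℕ) (u : ℂ) (n m : ℕ) (hnm : n ≤ m) : Y d u n →ₐ[ℂ] Y d u m :=
  RingQuot.liftAlgHom ℂ ⟨FreeAlgebra.lift ℂ (Y.genMap d u hnm), Y.genMap_rel d u hnm⟩

theorem Y.incl_mk (d : ℕ) (u : ℂ) (n m : ℕ) (hnm : n ≤ m) (a : FreeAlgebra ℂ (Gen n)) :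
    Y.incl d u n m hnm (Y.mk d u n a) = FreeAlgebra.lift ℂ (Y.genMap d u hnm) a :=
  RingQuot.liftAlgHom_mkAlgHom_apply ..

theorem Y.incl_t (d : ℕ) (u : ℂ) (n m : ℕ) (hnm : n ≤ m) (j : ℕ) (h : 1 ≤ j ∧ j ≤ n) :
    Y.incl d u n m hnm (Y.t d u n j h) = Y.t d u m j ⟨h.1, h.2.trans hnm⟩ := by
  rw [Y.t, Y.incl_mk]; simp [tF, Y.genMap]

theorem Y.incl_g (d : ℕ) (u : ℂ) (n m : ℕ) (hnm : n ≤ m) (i : ℕ) (h : 1 ≤ i ∧ i < n) :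
    Y.incl d u n m hnm (Y.g d u n i h) = Y.g d u m i ⟨h.1, h.2.trans_le hnm⟩ := by
  rw [Y.g, Y.incl_mk]; simp [gF, Y.genMap]

/-- Algebra maps out of `Y_{d,n}(u)` that agree on the generators are equal. -/
theorem Y.hom_ext {d : ℕ} {u : ℂ} {n : ℕ} {A : Type} [Ring A] [Algebra ℂ A]
    {f f' : Y d u n →ₐ[ℂ] A} (ht : ∀ j h, f (Y.t d u n j h) = f' (Y.t d u n j h))
    (hg : ∀ i h, f (Y.g d u n i h) = f' (Y.g d u n i h)) : f = f' := by
  refine RingQuot.ringQuot_ext' ℂ f f' (FreeAlgebra.hom_ext (funext fun x => ?_))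
  cases x with
  | t j h => exact ht j h
  | g i h => exact hg i h

instance (d : ℕ) (u : ℂ) : DirectedSystem (Y d u) (fun n m h => Y.incl d u n m h) where
  map_self n a := by
    have : Y.incl d u n n le_rfl = AlgHom.id ℂ _ :=
      Y.hom_ext (fun j h => by simp [Y.incl_t]) (fun i h => by simp [Y.incl_g])
    exact DFunLike.congr_fun this a
  map_map k j i hij hjk a := by
    have : (Y.incl d u j k hjk).comp (Y.incl d u i j hij) = Y.incl d u i k (hij.trans hjk) :=
      Y.hom_ext (fun j h => by simp [Y.incl_t]) (fun i h => by simp [Y.incl_g])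
    exact DFunLike.congr_fun this a

/-- `Y_{d,∞}(u)`, the inductive limit of the algebras `Y_{d,n}(u)`. -/
def YInf (d : ℕ) (u : ℂ) : Type := DirectLimit (Y d u) (Y.incl d u)

instance (d : ℕ) (u : ℂ) : Ring (YInf d u) :=
  inferInstanceAs (Ring (DirectLimit (Y d u) (Y.incl d u)))

instance (d : ℕ) (u : ℂ) : Algebra ℂ (YInf d u) :=
  inferInstanceAs (Algebra ℂ (DirectLimit (Y d u) (Y.incl d u)))

/-- The canonical map `Y_{d,n}(u) → Y_{d,∞}(u)`. -/
def Y.toInf (d : ℕ) (u : ℂ) (n : ℕ) : Y d u n →ₐ[ℂ] YInf d u where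
  __ := DirectLimit.Ring.of (Y d u) (Y.incl d u) n
  commutes' r := (DirectLimit.algebraMap_def n r).symm

/-- The element `t_j` of `Y_{d,∞}(u)`. -/
def YInf.t (d : ℕ) (u : ℂ) (j : ℕ) (h : 1 ≤ j := by omega) : YInf d u :=
  Y.toInf d u j (Y.t d u j j)

/-- The element `g_i` of `Y_{d,∞}(u)`. -/
def YInf.g (d : ℕ) (u : ℂ) (i : ℕ) (h : 1 ≤ i := by omega) : YInf d u :=
  Y.toInf d u (i + 1) (Y.g d u (i + 1) i)

/-- The element `e_i` of `Y_{d,∞}(u)`. -/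
def YInf.e (d : ℕ) (u : ℂ) (i : ℕ) (h : 1 ≤ i := by omega) : YInf d u :=
  avg d (YInf.t d u i) (YInf.t d u (i + 1))

/-- The elements of `Y_{d,n}(u)` that are set to zero in the Yokonuma-Temperley-Lieb algebra. -/
inductive YTLRel (d : ℕ) (u : ℂ) (n : ℕ) : Y d u n → Y d u n → Prop
  | linear (i : ℕ) (hi : 1 ≤ i ∧ i < n) (hi' : 1 ≤ i + 1 ∧ i + 1 < n) :
      YTLRel d u n (lin (Y.g d u n i hi) (Y.g d u n (i + 1) hi')) 0

/-- The Yokonuma-Temperley-Lieb algebra `YTL_{d,n}(u)`. -/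
def YTL (d : ℕ) (u : ℂ) (n : ℕ) : Type := RingQuot (YTLRel d u n)

instance (d : ℕ) (u : ℂ) (n : ℕ) : Ring (YTL d u n) :=
  inferInstanceAs (Ring (RingQuot (YTLRel d u n)))

instance (d : ℕ) (u : ℂ) (n : ℕ) : Algebra ℂ (YTL d u n) :=
  inferInstanceAs (Algebra ℂ (RingQuot (YTLRel d u n)))

/-- The quotient map `Y_{d,n}(u) → YTL_{d,n}(u)`. -/
def YTL.mk (d : ℕ) (u : ℂ) (n : ℕ) : Y d u n →ₐ[ℂ] YTL d u n :=
  RingQuot.mkAlgHom ℂ (YTLRel d u n)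

theorem YTL.incl_rel (d : ℕ) (u : ℂ) (n m : ℕ) (hnm : n ≤ m) ⦃a b : Y d u n⦄
    (h : YTLRel d u n a b) :
    (YTL.mk d u m).comp (Y.incl d u n m hnm) a = (YTL.mk d u m).comp (Y.incl d u n m hnm) b := by
  cases h with
  | linear i hi hi' =>
    simp only [AlgHom.comp_apply, map_lin (Y.incl d u n m hnm), Y.incl_g, map_zero]
    have := RingQuot.mkAlgHom_rel ℂ (YTLRel.linear (d := d) (u := u) (n := m) i
      ⟨hi.1, hi.2.trans_le hnm⟩ ⟨hi'.1, hi'.2.trans_le hnm⟩)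
    exact this.trans (map_zero _)

/-- The natural map `YTL_{d,n}(u) → YTL_{d,m}(u)` for `n ≤ m`, induced by `Y_{d,n} → Y_{d,m}`. -/
def YTL.incl (d : ℕ) (u : ℂ) (n m : ℕ) (hnm : n ≤ m) : YTL d u n →ₐ[ℂ] YTL d u m :=
  RingQuot.liftAlgHom ℂ ⟨(YTL.mk d u m).comp (Y.incl d u n m hnm), YTL.incl_rel d u n m hnm⟩

theorem YTL.incl_mk (d : ℕ) (u : ℂ) (n m : ℕ) (hnm : n ≤ m) (a : Y d u n) :
    YTL.incl d u n m hnm (YTL.mk d u n a) = YTL.mk d u m (Y.incl d u n m hnm a) :=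
  RingQuot.liftAlgHom_mkAlgHom_apply ..

theorem YTL.mk_surjective (d : ℕ) (u : ℂ) (n : ℕ) : Function.Surjective (YTL.mk d u n) :=
  RingQuot.mkAlgHom_surjective ℂ (YTLRel d u n)

instance (d : ℕ) (u : ℂ) : DirectedSystem (YTL d u) (fun n m h => YTL.incl d u n m h) where
  map_self n a := by
    obtain ⟨a, rfl⟩ := YTL.mk_surjective d u n a
    rw [YTL.incl_mk, DirectedSystem.map_self (f := fun n m h => Y.incl d u n m h)]
  map_map k j i hij hjk a := by
    obtain ⟨a, rfl⟩ := YTL.mk_surjective d u i a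
    rw [YTL.incl_mk, YTL.incl_mk, YTL.incl_mk,
      DirectedSystem.map_map (f := fun n m h => Y.incl d u n m h)]

/-- `YTL_{d,∞}(u)`, the inductive limit of the algebras `YTL_{d,n}(u)`. -/
def YTLInf (d : ℕ) (u : ℂ) : Type := DirectLimit (YTL d u) (YTL.incl d u)

instance (d : ℕ) (u : ℂ) : Ring (YTLInf d u) :=
  inferInstanceAs (Ring (DirectLimit (YTL d u) (YTL.incl d u)))

instance (d : ℕ) (u : ℂ) : Algebra ℂ (YTLInf d u) :=
  inferInstanceAs (Algebra ℂ (DirectLimit (YTL d u) (YTL.incl d u)))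

/-- The canonical map `YTL_{d,n}(u) → YTL_{d,∞}(u)`. -/
def YTL.toInf (d : ℕ) (u : ℂ) (n : ℕ) : YTL d u n →ₐ[ℂ] YTLInf d u where
  __ := DirectLimit.Ring.of (YTL d u) (YTL.incl d u) n
  commutes' r := (DirectLimit.algebraMap_def n r).symm

theorem YTL.toInf_incl (d : ℕ) (u : ℂ) (n m : ℕ) (hnm : n ≤ m) (a : YTL d u n) :
    YTL.toInf d u m (YTL.incl d u n m hnm a) = YTL.toInf d u n a :=
  DirectLimit.Ring.of_f ..

/-- The map `Y_{d,∞}(u) → YTL_{d,∞}(u)` induced by the quotient maps `Y_{d,n} → YTL_{d,n}`. -/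
def YTLInf.mk (d : ℕ) (u : ℂ) : YInf d u →+* YTLInf d u :=
  DirectLimit.Ring.lift (Y d u) (Y.incl d u) (YTLInf d u)
    (fun n => ((YTL.toInf d u n).comp (YTL.mk d u n) : Y d u n →+* YTLInf d u))
    (fun n m h a => by
      show YTL.toInf d u m (YTL.mk d u m (Y.incl d u n m h a)) =
        YTL.toInf d u n (YTL.mk d u n a)
      rw [← YTL.incl_mk, YTL.toInf_incl])

theorem YTLInf.mk_toInf (d : ℕ) (u : ℂ) (n : ℕ) (a : Y d u n) :
    YTLInf.mk d u (Y.toInf d u n a) = YTL.toInf d u n (YTL.mk d u n a) :=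
  rfl

/-- The Juyumaya trace on `Y_{d,∞}(u)` with parameters `z` and `x_1, …, x_{d-1}`
(here `x s` stands for `x_{s+1}`, `0 ≤ s < d - 1`): the linear functional determined by the
following four rules. -/
structure IsJuyumayaTrace (d : ℕ) (u z : ℂ) (x : Fin (d - 1) → ℂ)
    (tr : YInf d u →ₗ[ℂ] ℂ) : Prop where
  trace_mul_comm : ∀ a b : YInf d u, tr (a * b) = tr (b * a)
  trace_one : tr 1 = 1
  markov : ∀ (n : ℕ) (hn : 1 ≤ n) (a b : Y d u n),
    tr (Y.toInf d u n a * YInf.g d u n hn * Y.toInf d u n b) = z * tr (Y.toInf d u n (a * b))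
  framing : ∀ (n : ℕ) (a : Y d u n) (s : Fin (d - 1)),
    tr (Y.toInf d u n a * YInf.t d u (n + 1) ^ ((s : ℕ) + 1)) = x s * tr (Y.toInf d u n a)

/-- The functional `tr` on `Y_{d,∞}(u)` passes through to the quotient `YTL_{d,∞}(u)`. -/
def FactorsThroughYTLInf (d : ℕ) (u : ℂ) (tr : YInf d u →ₗ[ℂ] ℂ) : Prop :=
  ∃ τ : YTLInf d u →ₗ[ℂ] ℂ, ∀ a : YInf d u, τ (YTLInf.mk d u a) = tr a

/-- The restriction of the functional `tr` to `Y_{d,n}(u)` passes through to the quotient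
`YTL_{d,n}(u)`. -/
def FactorsThroughYTL (d : ℕ) (u : ℂ) (n : ℕ) (tr : YInf d u →ₗ[ℂ] ℂ) : Prop :=
  ∃ τ : YTL d u n →ₗ[ℂ] ℂ, ∀ a : Y d u n, τ (YTL.mk d u n a) = tr (Y.toInf d u n a)

/-- The parameter `x_k` for an arbitrary exponent `k`, read modulo `d`, with `x_0 = 1`. -/
def xPar (d : ℕ) (x : Fin (d - 1) → ℂ) (k : ℕ) : ℂ :=
  if h : 1 ≤ k % d ∧ k % d < d then x ⟨k % d - 1, by omega⟩ else 1

/-- `E_d = (1/d) ∑_{m=0}^{d-1} x_m x_{-m}`, indices modulo `d`. -/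
def Ed (d : ℕ) (x : Fin (d - 1) → ℂ) : ℂ :=
  (1 / (d : ℂ)) * ∑ m ∈ Finset.range d, xPar d x m * xPar d x (d - m)

/-- The value `z_1` of the trace parameter (for `u ≠ -1`). -/
def z₁ (u E : ℂ) : ℂ :=
  (-(u * E) + Complex.sqrt ((u * E - E + 3) ^ 2 - 4 * (u + 1)) + E - 3) / (2 * (u + 1))

/-- The value `z_2` of the trace parameter (for `u ≠ -1`). -/
def z₂ (u E : ℂ) : ℂ :=
  (-(u * E) - Complex.sqrt ((u * E - E + 3) ^ 2 - 4 * (u + 1)) + E - 3) / (2 * (u + 1))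

end Yokonuma

end

/-! The framings move past the braiding generators, so the Markov and framing rules alone evaluate
the trace of t_i^a t_{i+1}^b t_{i+2}^c L_i (`tr_ttt_lin`): a polynomial in z of degree at most two
whose z² coefficient is (u+1) x_{a+b+c}. At a = b = c = 0 it is the quadratic of part (1).

If the trace factors, the polynomials for i = 1 vanish for all a, b, c. Subtracting x_{a+b+c} times
the basic quadratic removes z² and leaves an equation B z + c₀ = 0. Eliminating z from it and the
quadratic gives a resultant `obs` in the x_k alone, so nonvanishing of `obs` excludes every z at
once.

It remains to see that `obs` is not the zero polynomial when a, b, c are not all divisible by d.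
Setting all of X_1, …, X_{d-1} equal to a single indeterminate suffices (`obs_constPar_ne_zero`):
after removing an explicit factor, the leading coefficient is a nonzero multiple of a power of
(u-1)(d-1)/d. Since t_j^d = 1, only finitely many exponent triples matter, and P is the product of
their resultants. -/

namespace Yokonuma

/-! ### Defining relations in the inductive limit -/

section Relations

variable {d : ℕ} {u : ℂ}

theorem Y.toInf_incl (n m : ℕ) (hnm : n ≤ m) (a : Y d u n) :
    Y.toInf d u m (Y.incl d u n m hnm a) = Y.toInf d u n a :=
  DirectLimit.Ring.of_f ..

theorem Y.toInf_t (n j : ℕ) (h : 1 ≤ j ∧ j ≤ n) :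
    Y.toInf d u n (Y.t d u n j h) = YInf.t d u j h.1 := by
  rw [YInf.t, ← Y.toInf_incl j n h.2, Y.incl_t]

theorem Y.toInf_g (n i : ℕ) (h : 1 ≤ i ∧ i < n) :
    Y.toInf d u n (Y.g d u n i h) = YInf.g d u i h.1 := by
  rw [YInf.g, ← Y.toInf_incl (i + 1) n h.2, Y.incl_g]

theorem YInf.t_mem {n j : ℕ} (h : 1 ≤ j) (hn : j ≤ n) :
    YInf.t d u j h ∈ (Y.toInf d u n).range :=
  ⟨Y.t d u n j ⟨h, hn⟩, Y.toInf_t n j _⟩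

theorem YInf.g_mem {n i : ℕ} (h : 1 ≤ i) (hn : i < n) :
    YInf.g d u i h ∈ (Y.toInf d u n).range :=
  ⟨Y.g d u n i ⟨h, hn⟩, Y.toInf_g n i _⟩

/-- The composite of the quotient map from the free algebra with the map to the limit. -/
noncomputable def toInfF (d : ℕ) (u : ℂ) (n : ℕ) : FreeAlgebra ℂ (Gen n) →ₐ[ℂ] YInf d u :=
  (Y.toInf d u n).comp (Y.mk d u n)

theorem toInfF_rel {n : ℕ} {a b : FreeAlgebra ℂ (Gen n)} (h : YRel d u n a b) :
    toInfF d u n a = toInfF d u n b :=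
  congrArg (Y.toInf d u n) (Y.mk_rel h)

theorem toInfF_t (n j : ℕ) (h : 1 ≤ j ∧ j ≤ n) : toInfF d u n (tF j h) = YInf.t d u j h.1 :=
  Y.toInf_t n j h

theorem toInfF_g (n i : ℕ) (h : 1 ≤ i ∧ i < n) : toInfF d u n (gF i h) = YInf.g d u i h.1 :=
  Y.toInf_g n i h

theorem YInf.t_comm (j k : ℕ) (hj : 1 ≤ j) (hk : 1 ≤ k) :
    Commute (YInf.t d u j hj) (YInf.t d u k hk) := by
  have := toInfF_rel (YRel.comm (d := d) (u := u) (n := max j k) j k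
    ⟨hj, le_max_left _ _⟩ ⟨hk, le_max_right _ _⟩)
  simp only [map_mul, toInfF_t] at this
  exact this

theorem YInf.t_pow_d (j : ℕ) (hj : 1 ≤ j) : YInf.t d u j hj ^ d = 1 := by
  have := toInfF_rel (YRel.modular (d := d) (u := u) (n := j) j ⟨hj, le_rfl⟩)
  simpa only [map_pow, map_one, toInfF_t] using this

theorem YInf.g_mul_t (i : ℕ) (hi : 1 ≤ i) :
    SemiconjBy (YInf.g d u i hi) (YInf.t d u i hi) (YInf.t d u (i + 1) i.succ_pos) := by
  have := toInfF_rel (YRel.mixed_left (d := d) (u := u) (n := i + 1) i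
    ⟨hi, by omega⟩ ⟨hi, by omega⟩ ⟨by omega, by omega⟩)
  simp only [map_mul, toInfF_t, toInfF_g] at this
  exact this

theorem YInf.g_mul_t_succ (i : ℕ) (hi : 1 ≤ i) :
    SemiconjBy (YInf.g d u i hi) (YInf.t d u (i + 1) i.succ_pos) (YInf.t d u i hi) := by
  have := toInfF_rel (YRel.mixed_right (d := d) (u := u) (n := i + 1) i
    ⟨hi, by omega⟩ ⟨hi, by omega⟩ ⟨by omega, by omega⟩)
  simp only [map_mul, toInfF_t, toInfF_g] at this
  exact this

theorem YInf.g_comm_t (i j : ℕ) (hi : 1 ≤ i) (hj : 1 ≤ j) (h : j ≠ i) (h' : j ≠ i + 1) :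
    Commute (YInf.g d u i hi) (YInf.t d u j hj) := by
  have := toInfF_rel (YRel.mixed_far (d := d) (u := u) (n := i + j) i j
    ⟨hi, by omega⟩ ⟨hj, by omega⟩ h h')
  simp only [map_mul, toInfF_t, toInfF_g] at this
  exact this

theorem YInf.g_sq (i : ℕ) (hi : 1 ≤ i) :
    YInf.g d u i hi ^ 2 =
      1 + (u - 1) • YInf.e d u i hi + (u - 1) • (YInf.e d u i hi * YInf.g d u i hi) := by
  have := toInfF_rel (YRel.quadratic (d := d) (u := u) (n := i + 1) i
    ⟨hi, by omega⟩ ⟨hi, by omega⟩ ⟨by omega, by omega⟩)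
  simpa only [map_mul, map_pow, map_add, map_one, map_smul, map_avg, toInfF_t, toInfF_g,
    YInf.e] using this

end Relations

/-! ### Periodic parameter sequences and shifted averages -/

section Parameters

variable {d : ℕ} (x : Fin (d - 1) → ℂ)

theorem xPar_zero : xPar d x 0 = 1 := by
  simp [xPar]

theorem xPar_add_self (k : ℕ) : xPar d x (k + d) = xPar d x k := by
  simp [xPar]

/-- `(1/d) ∑_{m=0}^{d-1} x_{p+m} x_{q-m}` for a sequence `x` of period `d`. -/
noncomputable def EdShift {R : Type*} [CommRing R] [Algebra ℂ R] (d : ℕ) (f : ℕ → R) (p q : ℕ) :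
    R :=
  (1 / (d : ℂ)) • ∑ m ∈ Finset.range d, f (p + m) * f (q + (d - m))

theorem EdShift_zero : EdShift d (xPar d x) 0 0 = Ed d x := by
  simp [EdShift, Ed]

end Parameters

/-! ### Trace values on two and three strands -/

namespace IsJuyumayaTrace

variable {d : ℕ} {u z : ℂ} {x : Fin (d - 1) → ℂ} {tr : YInf d u →ₗ[ℂ] ℂ}

theorem tr_mul_g_mul (h : IsJuyumayaTrace d u z x tr) {n : ℕ} (hn : 1 ≤ n) {a b : YInf d u}
    (ha : a ∈ (Y.toInf d u n).range) (hb : b ∈ (Y.toInf d u n).range) :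
    tr (a * YInf.g d u n hn * b) = z * tr (a * b) := by
  obtain ⟨a, rfl⟩ := ha
  obtain ⟨b, rfl⟩ := hb
  simpa using h.markov n hn a b

theorem tr_mul_t_pow (h : IsJuyumayaTrace d u z x tr) (hd : 1 ≤ d) {n : ℕ} {a : YInf d u}
    (ha : a ∈ (Y.toInf d u n).range) (k : ℕ) :
    tr (a * YInf.t d u (n + 1) ^ k) = xPar d x k * tr a := by
  obtain ⟨a, rfl⟩ := ha
  have hk : YInf.t d u (n + 1) ^ k = YInf.t d u (n + 1) ^ (k % d) :=
    pow_eq_pow_mod k (YInf.t_pow_d _ _)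
  rw [hk]
  have hlt := Nat.mod_lt k hd
  by_cases h0 : k % d = 0
  · simp [xPar, h0]
  · have hpos : 1 ≤ k % d := by omega
    have := h.framing n a ⟨k % d - 1, by omega⟩
    simp only [Nat.sub_add_cancel hpos] at this
    rw [xPar, dif_pos ⟨hpos, hlt⟩]
    exact this

theorem tr_t_pow (h : IsJuyumayaTrace d u z x tr) (hd : 1 ≤ d) (i : ℕ) (hi : 1 ≤ i) (a : ℕ) :
    tr (YInf.t d u i hi ^ a) = xPar d x a := by
  obtain ⟨n, rfl⟩ : ∃ n, i = n + 1 := ⟨i - 1, by omega⟩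
  simpa [h.trace_one] using h.tr_mul_t_pow hd (n := n) (one_mem _) a

theorem tr_t_t (h : IsJuyumayaTrace d u z x tr) (hd : 1 ≤ d) (i : ℕ) (hi : 1 ≤ i) (a b : ℕ) :
    tr (YInf.t d u i hi ^ a * YInf.t d u (i + 1) i.succ_pos ^ b) = xPar d x a * xPar d x b := by
  rw [h.tr_mul_t_pow hd (pow_mem (YInf.t_mem hi le_rfl) _), h.tr_t_pow hd, mul_comm]

theorem tr_t_t_g (h : IsJuyumayaTrace d u z x tr) (hd : 1 ≤ d) (i : ℕ) (hi : 1 ≤ i) (a b : ℕ) :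
    tr (YInf.t d u i hi ^ a * YInf.t d u (i + 1) i.succ_pos ^ b * YInf.g d u i hi) =
      z * xPar d x (a + b) := by
  rw [mul_assoc, ← ((YInf.g_mul_t i hi).pow_right b).eq, ← mul_assoc,
    h.tr_mul_g_mul hi (pow_mem (YInf.t_mem hi le_rfl) _) (pow_mem (YInf.t_mem hi le_rfl) _),
    ← pow_add, h.tr_t_pow hd]

theorem t_t_mul_e (i : ℕ) (hi : 1 ≤ i) (p q : ℕ) :
    YInf.t d u i hi ^ p * YInf.t d u (i + 1) i.succ_pos ^ q * YInf.e d u i hi =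
      (1 / (d : ℂ)) • ∑ m ∈ Finset.range d,
        YInf.t d u i hi ^ (p + m) * YInf.t d u (i + 1) i.succ_pos ^ (q + (d - m)) := by
  simp only [YInf.e, avg, mul_smul_comm, Finset.mul_sum]
  congr 1
  refine Finset.sum_congr rfl fun m _ => ?_
  simp only [pow_add, mul_assoc]
  congr 1
  simp only [← mul_assoc]
  congr 1
  exact ((YInf.t_comm _ _ _ _).pow_pow _ _).eq

theorem tr_t_t_e (h : IsJuyumayaTrace d u z x tr) (hd : 1 ≤ d) (i : ℕ) (hi : 1 ≤ i) (p q : ℕ) :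
    tr (YInf.t d u i hi ^ p * YInf.t d u (i + 1) i.succ_pos ^ q * YInf.e d u i hi) = EdShift d (xPar d x) p q := by
  simp only [t_t_mul_e, map_smul, map_sum, h.tr_t_t hd, EdShift, smul_eq_mul]

/-- Moving t_{i+1} across g_i merges both framings on one strand, where the exponents m and d - m of
the average add up to d. All d summands therefore have the same trace. -/
theorem tr_t_t_e_g (h : IsJuyumayaTrace d u z x tr) (hd : 1 ≤ d) (i : ℕ) (hi : 1 ≤ i)
    (p q : ℕ) :
    tr (YInf.t d u i hi ^ p * YInf.t d u (i + 1) i.succ_pos ^ q * (YInf.e d u i hi * YInf.g d u i hi)) =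
      z * xPar d x (p + q) := by
  rw [← mul_assoc, t_t_mul_e, smul_mul_assoc, Finset.sum_mul]
  simp only [map_smul, map_sum, h.tr_t_t_g hd, smul_eq_mul]
  have : ∀ m ∈ Finset.range d, z * xPar d x (p + m + (q + (d - m))) = z * xPar d x (p + q) := by
    intro m hm
    have : p + m + (q + (d - m)) = p + q + d := by have := Finset.mem_range.1 hm; omega
    rw [this, xPar_add_self]
  rw [Finset.sum_congr rfl this]
  have : (d : ℂ) ≠ 0 := by exact_mod_cast (by omega : d ≠ 0)
  simp
  field_simp

theorem tr_t_t_g_sq (h : IsJuyumayaTrace d u z x tr) (hd : 1 ≤ d) (i : ℕ) (hi : 1 ≤ i)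
    (p q : ℕ) :
    tr (YInf.t d u i hi ^ p * YInf.t d u (i + 1) i.succ_pos ^ q * YInf.g d u i hi ^ 2) =
      xPar d x p * xPar d x q + (u - 1) * EdShift d (xPar d x) p q + (u - 1) * (z * xPar d x (p + q)) := by
  simp only [YInf.g_sq, mul_add, mul_one, mul_smul_comm, map_add, map_smul, h.tr_t_t hd,
    h.tr_t_t_e hd, h.tr_t_t_e_g hd, smul_eq_mul]

section ThreeStrands

variable (h : IsJuyumayaTrace d u z x tr) (hd : 1 ≤ d) (i : ℕ) (hi : 1 ≤ i) (a b c : ℕ)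
include h

/-- Crossing g_{i+1} turns t_{i+2}^c into t_{i+1}^c. Then g_{i+1} has only elements of the algebra
on i+1 strands on either side, and the Markov rule removes it. -/
theorem tr_ttt_g_succ_mul {y : YInf d u} (hy : y ∈ (Y.toInf d u (i + 1)).range) :
    tr (YInf.t d u i hi ^ a * YInf.t d u (i + 1) i.succ_pos ^ b * YInf.t d u (i + 2) ^ c *
      (YInf.g d u (i + 1) i.succ_pos * y)) =
      z * tr (YInf.t d u i hi ^ a * YInf.t d u (i + 1) i.succ_pos ^ (b + c) * y) := by
  have e := ((YInf.g_mul_t (d := d) (u := u) (i + 1) i.succ_pos).pow_right c).eq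
  rw [mul_assoc, ← mul_assoc (_ ^ c), ← e, mul_assoc (YInf.g _ _ _ _), ← mul_assoc,
    h.tr_mul_g_mul (by omega) (mul_mem (pow_mem (YInf.t_mem hi (by omega)) _)
    (pow_mem (YInf.t_mem _ le_rfl) _)) (mul_mem (pow_mem (YInf.t_mem _ le_rfl) _) hy), pow_add]
  simp only [mul_assoc]

/-- The power t_{i+2}^c commutes with g_i and becomes t_{i+1}^c across g_{i+1}. Once the Markov rule
has removed g_{i+1}, it is carried back across g_i and becomes t_i^c. Taking y = g_i leaves g_i²,
the source of the shifted average in `tr_ttt_lin`. -/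
theorem tr_ttt_g_g_succ_mul {y : YInf d u} (hy : y ∈ (Y.toInf d u (i + 1)).range) :
    tr (YInf.t d u i hi ^ a * YInf.t d u (i + 1) i.succ_pos ^ b * YInf.t d u (i + 2) ^ c *
      (YInf.g d u i hi * YInf.g d u (i + 1) i.succ_pos * y)) =
      z * tr (YInf.t d u i hi ^ (a + c) * YInf.t d u (i + 1) i.succ_pos ^ b * (YInf.g d u i hi * y)) := by
  have e₁ := ((YInf.g_comm_t (d := d) (u := u) i (i + 2) hi (by omega) (by omega)
    (by omega)).pow_right c).eq
  have e₂ := ((YInf.g_mul_t (d := d) (u := u) (i + 1) i.succ_pos).pow_right c).eq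
  have e₃ := ((YInf.g_mul_t_succ (d := d) (u := u) i hi).pow_right c).eq
  have e₄ := ((YInf.t_comm (d := d) (u := u) (i + 1) i (by omega) hi).pow_pow b c).eq
  set t₁ := YInf.t d u i hi
  set t₂ := YInf.t d u (i + 1) i.succ_pos
  set t₃ := YInf.t d u (i + 2)
  set g₁ := YInf.g d u i hi
  set g₂ := YInf.g d u (i + 1) i.succ_pos
  have key : t₁ ^ a * t₂ ^ b * t₃ ^ c * (g₁ * g₂ * y) =
      t₁ ^ a * t₂ ^ b * g₁ * g₂ * (t₂ ^ c * y) := by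
    calc _ = t₁ ^ a * t₂ ^ b * (t₃ ^ c * g₁) * g₂ * y := by simp only [mul_assoc]
      _ = t₁ ^ a * t₂ ^ b * g₁ * (t₃ ^ c * g₂) * y := by rw [← e₁]; simp only [mul_assoc]
      _ = _ := by rw [← e₂]; simp only [mul_assoc]
  have key₂ : t₁ ^ a * t₂ ^ b * g₁ * (t₂ ^ c * y) = t₁ ^ (a + c) * t₂ ^ b * (g₁ * y) := by
    calc _ = t₁ ^ a * t₂ ^ b * (g₁ * t₂ ^ c) * y := by simp only [mul_assoc]
      _ = t₁ ^ a * (t₂ ^ b * t₁ ^ c) * g₁ * y := by rw [e₃]; simp only [mul_assoc]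
      _ = _ := by rw [e₄, pow_add]; simp only [mul_assoc]
  rw [key, h.tr_mul_g_mul (by omega) (mul_mem (mul_mem (pow_mem (YInf.t_mem hi (by omega)) _)
    (pow_mem (YInf.t_mem _ le_rfl) _)) (YInf.g_mem _ (by omega)))
    (mul_mem (pow_mem (YInf.t_mem _ le_rfl) _) hy), key₂]

include hd

theorem tr_ttt :
    tr (YInf.t d u i hi ^ a * YInf.t d u (i + 1) i.succ_pos ^ b * YInf.t d u (i + 2) ^ c) =
      xPar d x a * xPar d x b * xPar d x c := by
  rw [h.tr_mul_t_pow hd (mul_mem (pow_mem (YInf.t_mem hi (by omega)) _)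
    (pow_mem (YInf.t_mem _ le_rfl) _)), h.tr_t_t hd, mul_comm]

theorem tr_ttt_g :
    tr (YInf.t d u i hi ^ a * YInf.t d u (i + 1) i.succ_pos ^ b * YInf.t d u (i + 2) ^ c *
      YInf.g d u i hi) = z * xPar d x (a + b) * xPar d x c := by
  rw [mul_assoc, ← ((YInf.g_comm_t i (i + 2) hi (by omega) (by omega) (by omega)).pow_right c).eq,
    ← mul_assoc, h.tr_mul_t_pow hd (mul_mem (mul_mem (pow_mem (YInf.t_mem hi (by omega)) _)
    (pow_mem (YInf.t_mem _ le_rfl) _)) (YInf.g_mem _ (by omega))), h.tr_t_t_g hd, mul_comm]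

theorem tr_ttt_g_succ :
    tr (YInf.t d u i hi ^ a * YInf.t d u (i + 1) i.succ_pos ^ b * YInf.t d u (i + 2) ^ c *
      YInf.g d u (i + 1) i.succ_pos) = z * (xPar d x a * xPar d x (b + c)) := by
  simpa [h.tr_t_t hd] using h.tr_ttt_g_succ_mul i hi a b c (one_mem _)

theorem tr_ttt_g_succ_g :
    tr (YInf.t d u i hi ^ a * YInf.t d u (i + 1) i.succ_pos ^ b * YInf.t d u (i + 2) ^ c *
      (YInf.g d u (i + 1) i.succ_pos * YInf.g d u i hi)) = z * (z * xPar d x (a + (b + c))) := by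
  rw [h.tr_ttt_g_succ_mul i hi a b c (YInf.g_mem _ (by omega)), h.tr_t_t_g hd]

theorem tr_ttt_g_g_succ :
    tr (YInf.t d u i hi ^ a * YInf.t d u (i + 1) i.succ_pos ^ b * YInf.t d u (i + 2) ^ c *
      (YInf.g d u i hi * YInf.g d u (i + 1) i.succ_pos)) = z * (z * xPar d x (a + c + b)) := by
  have := h.tr_ttt_g_g_succ_mul i hi a b c (one_mem _)
  rwa [mul_one, mul_one, h.tr_t_t_g hd] at this

theorem tr_ttt_g_g_succ_g :
    tr (YInf.t d u i hi ^ a * YInf.t d u (i + 1) i.succ_pos ^ b * YInf.t d u (i + 2) ^ c *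
      (YInf.g d u i hi * YInf.g d u (i + 1) i.succ_pos * YInf.g d u i hi)) =
      z * (xPar d x (a + c) * xPar d x b + (u - 1) * EdShift d (xPar d x) (a + c) b +
        (u - 1) * (z * xPar d x (a + c + b))) := by
  rw [h.tr_ttt_g_g_succ_mul i hi a b c (YInf.g_mem _ (by omega)), ← sq, h.tr_t_t_g_sq hd]

/-- The trace of `t_i^a t_{i+1}^b t_{i+2}^c L_i`. -/
theorem tr_ttt_lin :
    tr (YInf.t d u i hi ^ a * YInf.t d u (i + 1) i.succ_pos ^ b * YInf.t d u (i + 2) ^ c *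
      lin (YInf.g d u i hi) (YInf.g d u (i + 1) i.succ_pos)) =
      (u + 1) * z ^ 2 * xPar d x (a + b + c) + z * ((u - 1) * EdShift d (xPar d x) (a + c) b +
        xPar d x (a + c) * xPar d x b + xPar d x (a + b) * xPar d x c +
        xPar d x a * xPar d x (b + c)) + xPar d x a * xPar d x b * xPar d x c := by
  simp only [lin, mul_add, map_add, mul_one, h.tr_ttt_g_g_succ_g hd, h.tr_ttt_g_g_succ hd,
    h.tr_ttt_g_succ_g hd, h.tr_ttt_g_succ hd, h.tr_ttt_g hd, h.tr_ttt hd]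
  rw [show a + (b + c) = a + b + c by omega, show a + c + b = a + b + c by omega]
  ring

end ThreeStrands

theorem tr_e (h : IsJuyumayaTrace d u z x tr) (hd : 1 ≤ d) (i : ℕ) (hi : 1 ≤ i) :
    tr (YInf.e d u i hi) = Ed d x := by
  simpa [EdShift_zero] using h.tr_t_t_e hd i hi 0 0

theorem tr_lin (h : IsJuyumayaTrace d u z x tr) (hd : 1 ≤ d) (i : ℕ) (hi : 1 ≤ i) :
    tr (lin (YInf.g d u i hi) (YInf.g d u (i + 1) i.succ_pos)) =
      (u + 1) * z ^ 2 + ((u - 1) * Ed d x + 3) * z + 1 := by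
  have := h.tr_ttt_lin hd i hi 0 0 0
  simp only [pow_zero, one_mul, add_zero, xPar_zero, EdShift_zero] at this
  rw [this]
  ring

end IsJuyumayaTrace

/-- The quadratic formula for the trace parameter. -/
theorem quadratic_iff {u : ℂ} (hu : u ≠ -1) (z E : ℂ) :
    (u + 1) * z ^ 2 + ((u - 1) * E + 3) * z + 1 = 0 ↔ z = z₁ u E ∨ z = z₂ u E := by
  have hu' : u + 1 ≠ 0 := fun h => hu (eq_neg_of_add_eq_zero_left h)
  -- The branch of the square root is irrelevant: the formula needs only that its square is the
  -- discriminant.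
  have sqrt_sq (w : ℂ) : Complex.sqrt w ^ 2 = w := by
    simp [Complex.sqrt]
  have hs : discrim (u + 1) ((u - 1) * E + 3) 1 =
      Complex.sqrt ((u * E - E + 3) ^ 2 - 4 * (u + 1)) *
        Complex.sqrt ((u * E - E + 3) ^ 2 - 4 * (u + 1)) := by
    rw [← sq, sqrt_sq, discrim]
    ring
  have := quadratic_eq_zero_iff hu' hs z
  rw [sq, this, z₁, z₂]
  ring_nf

/-- A functional that factors through the quotient kills the ideal it is taken by. -/
theorem FactorsThroughYTL.tr_mul_lin {d : ℕ} {u : ℂ} {n : ℕ} {tr : YInf d u →ₗ[ℂ] ℂ}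
    (h : FactorsThroughYTL d u n tr) (hn : 3 ≤ n) {a : YInf d u}
    (ha : a ∈ (Y.toInf d u n).range) :
    tr (a * lin (YInf.g d u 1) (YInf.g d u 2)) = 0 := by
  obtain ⟨τ, hτ⟩ := h
  obtain ⟨a, rfl⟩ := ha
  have hl : YTL.mk d u n (lin (Y.g d u n 1) (Y.g d u n 2)) = 0 :=
    (RingQuot.mkAlgHom_rel ℂ (YTLRel.linear (d := d) (u := u) (n := n) 1
      (by omega) (by omega))).trans (map_zero _)
  have := hτ (a * lin (Y.g d u n 1) (Y.g d u n 2))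
  rw [map_mul, hl, mul_zero, map_zero, map_mul, map_lin, Y.toInf_g, Y.toInf_g] at this
  exact this.symm

theorem FactorsThroughYTLInf.factorsThroughYTL {d : ℕ} {u : ℂ} {tr : YInf d u →ₗ[ℂ] ℂ}
    (h : FactorsThroughYTLInf d u tr) (n : ℕ) : FactorsThroughYTL d u n tr := by
  obtain ⟨τ, hτ⟩ := h
  exact ⟨τ.comp (YTL.toInf d u n).toLinearMap, fun a => by
    rw [← hτ, YTLInf.mk_toInf]; rfl⟩

end Yokonuma

namespace Yokonuma

/-! ### The resultant and its specialization to one indeterminate -/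

section Obstruction

open Polynomial

/-- The defining equation of the trace parameter has the form `v z² + e z + 1 = 0`; if such a `z`
also satisfies `B z + c = 0`, then this combination vanishes. -/
theorem resultant_eq_zero {v e z B c : ℂ} (h₁ : v * z ^ 2 + e * z + 1 = 0) (h₂ : B * z + c = 0) :
    v * c ^ 2 - e * B * c + B ^ 2 = 0 := by
  have : c = -(B * z) := by linear_combination h₂
  subst this
  linear_combination B ^ 2 * h₁

variable {R S : Type*} [CommRing R] [Algebra ℂ R] [CommRing S] [Algebra ℂ S]

/-- The coefficient of `z` in `tr (t_1^a t_2^b t_3^c L_1) - x_{a+b+c} tr (L_1)`. -/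
noncomputable def obsLin (d : ℕ) (u : ℂ) (f : ℕ → R) (a b c : ℕ) : R :=
  algebraMap ℂ R (u - 1) * (EdShift d f (a + c) b - f (a + b + c) * EdShift d f 0 0) +
    f (a + c) * f b + f (a + b) * f c + f a * f (b + c) - 3 * f (a + b + c)

/-- The constant coefficient of `tr (t_1^a t_2^b t_3^c L_1) - x_{a+b+c} tr (L_1)`. -/
def obsConst (f : ℕ → R) (a b c : ℕ) : R :=
  f a * f b * f c - f (a + b + c)

/-- The resultant in `z` of `tr (L_1)` and `tr (t_1^a t_2^b t_3^c L_1) - x_{a+b+c} tr (L_1)`. -/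
noncomputable def obs (d : ℕ) (u : ℂ) (f : ℕ → R) (a b c : ℕ) : R :=
  algebraMap ℂ R (u + 1) * obsConst f a b c ^ 2 -
    (algebraMap ℂ R (u - 1) * EdShift d f 0 0 + 3) * obsLin d u f a b c * obsConst f a b c +
    obsLin d u f a b c ^ 2

theorem map_EdShift (φ : R →ₐ[ℂ] S) (d : ℕ) (f : ℕ → R) (p q : ℕ) :
    φ (EdShift d f p q) = EdShift d (fun k => φ (f k)) p q := by
  simp [EdShift, map_sum]

/-- Naturality lets one expression serve over three rings: complex numbers, polynomials in X_1, …,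
X_{d-1}, and polynomials in one variable. -/
theorem map_obs (φ : R →ₐ[ℂ] S) (d : ℕ) (u : ℂ) (f : ℕ → R) (a b c : ℕ) :
    φ (obs d u f a b c) = obs d u (fun k => φ (f k)) a b c := by
  simp only [obs, obsLin, obsConst, map_EdShift, map_add, map_sub, map_mul, map_pow, map_ofNat,
    AlgHom.commutes]

theorem sum_range_eq_sum_zmod {M : Type*} [AddCommMonoid M] (d : ℕ) [NeZero d] (f : ZMod d → M) :
    ∑ m ∈ Finset.range d, f m = ∑ m : ZMod d, f m := by
  refine Finset.sum_nbij' (fun m => (m : ZMod d)) ZMod.val ?_ ?_ ?_ ?_ ?_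
  · simp
  · simp [ZMod.val_lt]
  · intro m hm
    exact ZMod.val_cast_of_lt (Finset.mem_range.1 hm)
  · simp
  · simp

/-- The sequence with the value `1` at the multiples of `d` and `t` elsewhere. -/
def constPar (d : ℕ) (t : R) (k : ℕ) : R :=
  if d ∣ k then 1 else t

theorem EdShift_constPar (d : ℕ) (hd : 1 ≤ d) (t : R) (p q : ℕ) :
    EdShift d (constPar d t) p q = t ^ 2 + algebraMap ℂ R (1 / d) *
      (2 * t * (1 - t) + if d ∣ p + q then (1 - t) ^ 2 else 0) := by
  have : NeZero d := ⟨by omega⟩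
  -- Each factor is t plus a spike of height 1 - t, at m = -p and at m = q modulo d. The two spikes
  -- meet exactly when d divides p + q.
  have h₁ : ∀ m ∈ Finset.range d, constPar d t (p + m) * constPar d t (q + (d - m)) =
      (fun m : ZMod d => (t + if m = -p then 1 - t else 0) * (t + if m = q then 1 - t else 0))
        (m : ZMod d) := by
    intro m hm
    have hm := Finset.mem_range.1 hm
    have hp : (m : ZMod d) = -p ↔ d ∣ p + m := by
      rw [← ZMod.natCast_eq_zero_iff, eq_neg_iff_add_eq_zero]
      push_cast
      rw [add_comm]
    have hq : (m : ZMod d) = q ↔ d ∣ q + (d - m) := by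
      rw [← ZMod.natCast_eq_zero_iff]
      push_cast [Nat.cast_sub hm.le]
      rw [CharP.cast_eq_zero (ZMod d) d, zero_sub, ← sub_eq_add_neg, sub_eq_zero, eq_comm]
    simp only [hp, hq, constPar]
    split_ifs <;> ring
  have hpq : (q : ZMod d) = -p ↔ d ∣ p + q := by
    rw [← ZMod.natCast_eq_zero_iff, eq_neg_iff_add_eq_zero]
    push_cast
    rw [add_comm]
  have hd' : algebraMap ℂ R (1 / d) * (d : R) = 1 := by
    have : (d : ℂ) ≠ 0 := by exact_mod_cast (by omega : d ≠ 0)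
    rw [← map_natCast (algebraMap ℂ R) d, ← map_mul, one_div_mul_cancel this, map_one]
  rw [EdShift, Finset.sum_congr rfl h₁, sum_range_eq_sum_zmod d
    (fun m : ZMod d => (t + if m = -p then 1 - t else 0) * (t + if m = q then 1 - t else 0)),
    Algebra.smul_def]
  simp only [add_mul, mul_add, Finset.sum_add_distrib, ite_mul, mul_ite, zero_mul, mul_zero,
    Finset.sum_ite_eq', Finset.mem_univ, if_true, Finset.sum_const, Finset.card_univ, ZMod.card,
    nsmul_eq_mul, hpq]
  split_ifs <;> linear_combination t ^ 2 * hd'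

theorem quintic_coeff {q₀ q₁ q₂ q₃ q₄ q₅ : ℂ}
    (h : C q₀ + C q₁ * X + C q₂ * X ^ 2 + C q₃ * X ^ 3 + C q₄ * X ^ 4 + C q₅ * X ^ 5 = 0) :
    q₁ = 0 ∧ q₂ = 0 ∧ q₃ = 0 ∧ q₄ = 0 ∧ q₅ = 0 := by
  have key (n : ℕ) := congrArg (fun p : ℂ[X] => p.coeff n) h
  refine ⟨?_, ?_, ?_, ?_, ?_⟩
  · simpa [coeff_X, coeff_C, coeff_X_pow] using key 1
  · simpa [coeff_X, coeff_C, coeff_X_pow] using key 2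
  · simpa [coeff_X, coeff_C, coeff_X_pow] using key 3
  · simpa [coeff_X, coeff_C, coeff_X_pow] using key 4
  · simpa [coeff_X, coeff_C, coeff_X_pow] using key 5

/-! ### Cofactors with nonzero leading coefficient -/

section Nonvanishing

variable (v e m : ℂ) {k : ℂ} (hk : k ≠ 0)
include hk

theorem linear_ne_zero : C m + C k * X ≠ (0 : ℂ[X]) := fun h =>
  hk (quintic_coeff (q₀ := m) (q₁ := k) (q₂ := 0) (q₃ := 0) (q₄ := 0) (q₅ := 0)
    (by simpa using h)).1

theorem cubic_ne_zero :
    C v + (C e + C k * X ^ 2) * (C m + C k * X) + (C m + C k * X) ^ 2 ≠ (0 : ℂ[X]) := fun h =>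
  pow_ne_zero 2 hk (quintic_coeff (q₀ := v + e * m + m ^ 2) (q₁ := e * k + 2 * m * k)
    (q₂ := k * m + k ^ 2) (q₃ := k ^ 2) (q₄ := 0) (q₅ := 0) (by
      rw [← h]; simp only [map_add, map_mul, map_pow, map_ofNat, map_zero]; ring)).2.2.1

theorem quartic_ne_zero :
    C v * (1 + X) ^ 2 + (C e + C k * X ^ 2) * (C m + C k * X) * (1 + X) + (C m + C k * X) ^ 2 ≠
      (0 : ℂ[X]) := fun h =>
  pow_ne_zero 2 hk (quintic_coeff (q₀ := v + e * m + m ^ 2)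
    (q₁ := 2 * v + e * (m + k) + 2 * m * k)
    (q₂ := v + e * k + k * m + k ^ 2) (q₃ := k * (m + k)) (q₄ := k ^ 2) (q₅ := 0) (by
      rw [← h]; simp only [map_add, map_mul, map_pow, map_ofNat, map_zero]; ring)).2.2.2.1

theorem quadratic_ne_zero : C v - 2 * (C e + C k * X ^ 2) + 4 ≠ (0 : ℂ[X]) := fun h =>
  hk (by simpa using (quintic_coeff (q₀ := v - 2 * e + 4) (q₁ := 0) (q₂ := -2 * k) (q₃ := 0)
    (q₄ := 0) (q₅ := 0) (by
      rw [← h]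
      simp only [map_add, map_sub, map_neg, map_mul, map_ofNat, map_zero]; ring)).2.1)

theorem quintic_ne_zero :
    C v * (X ^ 2 + X + 1) ^ 2 - 3 * (C e + C k * X ^ 2) * (X + 1) * (X ^ 2 + X + 1) +
      9 * (X + 1) ^ 2 ≠ (0 : ℂ[X]) := fun h =>
  hk (by simpa using (quintic_coeff (q₀ := v - 3 * e + 9) (q₁ := 2 * v - 6 * e + 18)
    (q₂ := 3 * v - 6 * e - 3 * k + 9) (q₃ := 2 * v - 3 * e - 6 * k)
    (q₄ := v - 6 * k) (q₅ := -3 * k) (by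
      rw [← h]
      simp only [map_add, map_sub, map_neg, map_mul, map_ofNat]; ring)).2.2.2.2)

end Nonvanishing

/-- At most one of p, q is divisible by d. The constant j is 0 if exactly one is (product t) and 1
if neither is (product t²), so the case distinction is absorbed into a scalar. -/
theorem constPar_mul_of_not_dvd {d p q : ℕ} (h : ¬ d ∣ p + q) (t : ℂ[X]) :
    ∃ j : ℂ, constPar d t p * constPar d t q = t - C j * (t * (1 - t)) := by
  by_cases hp : d ∣ p <;> by_cases hq : d ∣ q
  · exact absurd (dvd_add hp hq) h
  · exact ⟨0, by simp [constPar, hp, hq]⟩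
  · exact ⟨0, by simp [constPar, hp, hq]⟩
  · exact ⟨1, by simp [constPar, hp, hq]; ring⟩

theorem constPar_mul_of_dvd {d p q : ℕ} (h : d ∣ p + q) (t : ℂ[X]) :
    constPar d t p * constPar d t q = if d ∣ q then 1 else t ^ 2 := by
  have : d ∣ p ↔ d ∣ q := ⟨fun hp => (Nat.dvd_add_right hp).1 h, fun hq => (Nat.dvd_add_left hq).1 h⟩
  by_cases hq : d ∣ q <;> simp [constPar, this, hq, sq]

/-- The cases are the number of exponents not divisible by d and whether d divides their sum. In
each, the square of a common factor of the linear and constant coefficients splits off, and the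
cofactor is one of the five polynomials above. -/
theorem obs_constPar_ne_zero {d : ℕ} (hd : 2 ≤ d) {u : ℂ} (hu : u ≠ 1) {a b c : ℕ}
    (h : ¬ (d ∣ a ∧ d ∣ b ∧ d ∣ c)) : obs d u (constPar d (X : ℂ[X])) a b c ≠ 0 := by
  have hd₀ : (d : ℂ) ≠ 0 := by exact_mod_cast (by omega : d ≠ 0)
  have hd₁ : (d : ℂ) - 1 ≠ 0 := by
    rw [sub_ne_zero]; exact_mod_cast (by omega : d ≠ 1)
  -- β and k are the coefficients in (u-1) E_d = β + k X² at equal parameters. The hypotheses u ≠ 1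
  -- and d ≥ 2 make k nonzero.
  obtain ⟨β, hβ⟩ : ∃ β : ℂ, β = (u - 1) / d := ⟨_, rfl⟩
  obtain ⟨k, hk⟩ : ∃ k : ℂ, k = β * (d - 1) := ⟨_, rfl⟩
  have hk₀ : k ≠ 0 := by
    rw [hk, hβ]
    exact mul_ne_zero (div_ne_zero (sub_ne_zero.2 hu) hd₀) hd₁
  have hku : u - 1 = k + β := by rw [hk, hβ]; field_simp; ring
  have hβd : C (u - 1) * C (1 / (d : ℂ)) = C β := by rw [← C_mul, hβ, mul_one_div]
  have hC : C (u - 1) = C k + C β := by rw [hku, C_add]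
  have hE : C (u - 1) * EdShift d (constPar d (X : ℂ[X])) 0 0 = C β + C k * X ^ 2 := by
    rw [EdShift_constPar d (by omega)]
    simp only [add_zero, dvd_zero, if_true, algebraMap_eq]
    linear_combination (2 * X * (1 - X) + (1 - X) ^ 2) * hβd + X ^ 2 * hC
  have hX : (X : ℂ[X]) ≠ 0 := X_ne_zero
  have hX₁ : (1 : ℂ[X]) - X ≠ 0 := by
    rw [← neg_sub, neg_ne_zero]
    simpa using X_sub_C_ne_zero (1 : ℂ)
  by_cases hs : d ∣ a + b + c
  · have e₁ := constPar_mul_of_dvd (p := a + c) (q := b) (d := d) (by rwa [add_right_comm]) X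
    have e₂ := constPar_mul_of_dvd (p := a + b) (q := c) hs X
    have e₃ := constPar_mul_of_dvd (p := b + c) (q := a) (d := d)
      (by rwa [add_comm, ← add_assoc]) X
    have es : constPar d (X : ℂ[X]) (a + b + c) = 1 := by simp [constPar, hs]
    have hEs : EdShift d (constPar d (X : ℂ[X])) (a + c) b =
        EdShift d (constPar d (X : ℂ[X])) 0 0 := by
      rw [EdShift_constPar d (by omega), EdShift_constPar d (by omega)]
      simp [hs, add_right_comm a c b]
    have hB : obsLin d u (constPar d (X : ℂ[X])) a b c =
        (if d ∣ b then 1 else X ^ 2) + (if d ∣ c then 1 else X ^ 2) +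
          (if d ∣ a then 1 else X ^ 2) - 3 := by
      rw [obsLin, hEs, es, e₁, e₂, mul_comm (constPar d X a), e₃]
      ring
    have hX₂ : (X : ℂ[X]) ^ 2 - 1 ≠ 0 := by
      simpa using X_pow_sub_C_ne_zero (by norm_num : 0 < 2) (1 : ℂ)
    have two : ∀ B c : ℂ[X], B = 2 * (X ^ 2 - 1) → c = X ^ 2 - 1 →
        C (u + 1) * c ^ 2 - (C β + C k * X ^ 2 + 3) * B * c + B ^ 2 ≠ 0 := by
      rintro B c rfl rfl
      convert mul_ne_zero (pow_ne_zero 2 hX₂) (quadratic_ne_zero (u + 1) (β + 3) hk₀) using 1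
      simp only [map_add, map_ofNat]
      ring
    have three : ∀ B c : ℂ[X], B = 3 * (X ^ 2 - 1) → c = X ^ 3 - 1 →
        C (u + 1) * c ^ 2 - (C β + C k * X ^ 2 + 3) * B * c + B ^ 2 ≠ 0 := by
      rintro B c rfl rfl
      convert mul_ne_zero (pow_ne_zero 2 hX₁) (quintic_ne_zero (u + 1) (β + 3) hk₀) using 1
      simp only [map_add, map_ofNat]
      ring
    rw [obs, algebraMap_eq, hE, hB, obsConst, es]
    -- As d divides the sum, a single non-divisible exponent is impossible; there are two or three.
    by_cases ha : d ∣ a <;> by_cases hb : d ∣ b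
    · exact absurd ⟨ha, hb, (Nat.dvd_add_right (dvd_add ha hb)).1 hs⟩ h
    · by_cases hc : d ∣ c
      · exact absurd ((Nat.dvd_add_right ha).1 ((Nat.dvd_add_left hc).1 hs)) hb
      · apply two <;> simp only [ha, hb, hc, constPar, if_true, if_false] <;> ring
    · by_cases hc : d ∣ c
      · exact absurd ((Nat.dvd_add_left hb).1 ((Nat.dvd_add_left hc).1 hs)) ha
      · apply two <;> simp only [ha, hb, hc, constPar, if_true, if_false] <;> ring
    · by_cases hc : d ∣ c
      · apply two <;> simp only [ha, hb, hc, constPar, if_true, if_false] <;> ring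
      · apply three <;> simp only [ha, hb, hc, constPar, if_false] <;> ring
  · obtain ⟨j₁, e₁⟩ := constPar_mul_of_not_dvd (d := d) (p := a + c) (q := b)
      (by rwa [add_right_comm]) X
    obtain ⟨j₂, e₂⟩ := constPar_mul_of_not_dvd (p := a + b) (q := c) hs X
    obtain ⟨j₃, e₃⟩ := constPar_mul_of_not_dvd (d := d) (p := a) (q := b + c)
      (by rwa [← add_assoc]) X
    have es : constPar d (X : ℂ[X]) (a + b + c) = X := by simp [constPar, hs]
    have hB : obsLin d u (constPar d (X : ℂ[X])) a b c =
        X * (1 - X) * (C (β - j₁ - j₂ - j₃) + C k * X) := by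
      rw [obsLin, es, e₁, e₂, e₃, algebraMap_eq, mul_sub, mul_left_comm (C (u - 1)), hE,
        EdShift_constPar d (by omega), add_right_comm a c b, if_neg hs, algebraMap_eq]
      simp only [map_sub C β, map_sub C (β - j₁), map_sub C (β - j₁ - j₂)]
      linear_combination (2 * X * (1 - X)) * hβd + X ^ 2 * hC
    have hXX : X * (1 - X) ≠ (0 : ℂ[X]) := mul_ne_zero hX hX₁
    have one : ∀ c : ℂ[X], c = 0 →
        C (u + 1) * c ^ 2 - (C β + C k * X ^ 2 + 3) *
          (X * (1 - X) * (C (β - j₁ - j₂ - j₃) + C k * X)) * c +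
          (X * (1 - X) * (C (β - j₁ - j₂ - j₃) + C k * X)) ^ 2 ≠ 0 := by
      rintro c rfl
      convert pow_ne_zero 2 (mul_ne_zero hXX (linear_ne_zero (β - j₁ - j₂ - j₃) hk₀)) using 1
      ring
    have two : ∀ c : ℂ[X], c = -(X * (1 - X)) →
        C (u + 1) * c ^ 2 - (C β + C k * X ^ 2 + 3) *
          (X * (1 - X) * (C (β - j₁ - j₂ - j₃) + C k * X)) * c +
          (X * (1 - X) * (C (β - j₁ - j₂ - j₃) + C k * X)) ^ 2 ≠ 0 := by
      rintro c rfl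
      convert mul_ne_zero (pow_ne_zero 2 hXX)
        (cubic_ne_zero (u + 1) (β + 3) (β - j₁ - j₂ - j₃) hk₀) using 1
      rw [C_add (a := β), show C (3 : ℂ) = 3 from map_ofNat C 3]
      ring
    have three : ∀ c : ℂ[X], c = -(X * (1 - X) * (1 + X)) →
        C (u + 1) * c ^ 2 - (C β + C k * X ^ 2 + 3) *
          (X * (1 - X) * (C (β - j₁ - j₂ - j₃) + C k * X)) * c +
          (X * (1 - X) * (C (β - j₁ - j₂ - j₃) + C k * X)) ^ 2 ≠ 0 := by
      rintro c rfl
      convert mul_ne_zero (pow_ne_zero 2 hXX)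
        (quartic_ne_zero (u + 1) (β + 3) (β - j₁ - j₂ - j₃) hk₀) using 1
      rw [C_add (a := β), show C (3 : ℂ) = 3 from map_ofNat C 3]
      ring
    rw [obs, algebraMap_eq, hE, hB, obsConst, es]
    -- With one, two or three non-divisible exponents the constant coefficient is 0, X² - X or X³ -
    -- X.
    by_cases ha : d ∣ a <;> by_cases hb : d ∣ b <;> by_cases hc : d ∣ c
    · exact absurd ⟨ha, hb, hc⟩ h
    · apply one; simp only [ha, hb, hc, constPar, if_true, if_false]; ring
    · apply one; simp only [ha, hb, hc, constPar, if_true, if_false]; ring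
    · apply two; simp only [ha, hb, hc, constPar, if_true, if_false]; ring
    · apply one; simp only [ha, hb, hc, constPar, if_true, if_false]; ring
    · apply two; simp only [ha, hb, hc, constPar, if_true, if_false]; ring
    · apply two; simp only [ha, hb, hc, constPar, if_true, if_false]; ring
    · apply three; simp only [ha, hb, hc, constPar, if_false]; ring

end Obstruction

/-! ### The generic polynomial P -/

section Genericity

open Polynomial

/-- The indeterminate `X_k`, with index read modulo `d` and `X_0 = 1`. -/
noncomputable def mvPar (d k : ℕ) : MvPolynomial (Fin (d - 1)) ℂ :=
  if h : 1 ≤ k % d ∧ k % d < d then MvPolynomial.X ⟨k % d - 1, by omega⟩ else 1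

theorem aeval_mvPar (d : ℕ) (x : Fin (d - 1) → ℂ) (k : ℕ) :
    MvPolynomial.aeval x (mvPar d k) = xPar d x k := by
  rw [mvPar, xPar]
  split_ifs <;> simp

theorem aeval_mvPar_const {d : ℕ} (hd : 1 ≤ d) (k : ℕ) :
    MvPolynomial.aeval (fun _ => (X : ℂ[X])) (mvPar d k) = constPar d X k := by
  rw [mvPar, constPar]
  have := Nat.mod_lt k hd
  by_cases h : d ∣ k
  · rw [dif_neg (by rw [Nat.mod_eq_zero_of_dvd h]; omega), if_pos h, map_one]
  · have : k % d ≠ 0 := fun h0 => h (Nat.dvd_of_mod_eq_zero h0)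
    rw [dif_pos (by omega), if_neg h, MvPolynomial.aeval_X]

/-- The product of the obstructions over all nonzero triples of exponents modulo `d`. -/
noncomputable def genericPoly (d : ℕ) (u : ℂ) : MvPolynomial (Fin (d - 1)) ℂ :=
  ∏ p ∈ (Finset.univ : Finset (Fin d × Fin d × Fin d)) with
      ¬ (d ∣ p.1 ∧ d ∣ p.2.1 ∧ d ∣ p.2.2),
    obs d u (mvPar d) p.1 p.2.1 p.2.2

theorem genericPoly_ne_zero {d : ℕ} (hd : 2 ≤ d) {u : ℂ} (hu : u ≠ 1) :
    genericPoly d u ≠ 0 := by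
  refine Finset.prod_ne_zero_iff.2 fun p hp h0 => ?_
  have := congrArg (MvPolynomial.aeval (fun _ => (X : ℂ[X]))) h0
  simp only [map_obs, aeval_mvPar_const (by omega : 1 ≤ d), map_zero] at this
  exact obs_constPar_ne_zero hd hu (Finset.mem_filter.1 hp).2 this

theorem obs_ne_zero_of_eval {d : ℕ} {u : ℂ} {x : Fin (d - 1) → ℂ}
    (hx : MvPolynomial.eval x (genericPoly d u) ≠ 0) (a b c : Fin d)
    (h : ¬ (d ∣ a ∧ d ∣ b ∧ d ∣ c)) : obs d u (xPar d x) a b c ≠ 0 := by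
  rw [genericPoly, map_prod, Finset.prod_ne_zero_iff] at hx
  have := hx (a, b, c) (by simpa using h)
  rw [← MvPolynomial.coe_aeval_eq_eval] at this
  simpa only [RingHom.coe_coe, map_obs, aeval_mvPar] using this

end Genericity

/-- The two sides compared in part (2) thus differ by exactly the trace of w L_1. -/
theorem mul_lin {A : Type} [Ring A] (w a b : A) :
    w * lin a b = w * (a * b * a) - w * (-(a * b) - b * a - a - b - 1) := by
  rw [lin, ← mul_sub]
  congr 1
  abel

theorem IsJuyumayaTrace.tr_ttt_lin_ne_zero {d : ℕ} {u z : ℂ} {x : Fin (d - 1) → ℂ}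
    {tr : YInf d u →ₗ[ℂ] ℂ} (h : IsJuyumayaTrace d u z x tr) (hd : 1 ≤ d)
    (hx : MvPolynomial.eval x (genericPoly d u) ≠ 0)
    (hz : (u + 1) * z ^ 2 + ((u - 1) * Ed d x + 3) * z + 1 = 0) {a b c : ℕ}
    (habc : ¬ (d ∣ a ∧ d ∣ b ∧ d ∣ c)) :
    tr (YInf.t d u 1 ^ a * YInf.t d u 2 ^ b * YInf.t d u 3 ^ c *
      lin (YInf.g d u 1) (YInf.g d u 2)) ≠ 0 := by
  -- P has factors only for residues modulo d, so the exponents are reduced first.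
  rw [pow_eq_pow_mod a (YInf.t_pow_d _ _), pow_eq_pow_mod b (YInf.t_pow_d _ _),
    pow_eq_pow_mod c (YInf.t_pow_d _ _), h.tr_ttt_lin hd 1 le_rfl]
  intro h0
  refine obs_ne_zero_of_eval hx ⟨a % d, Nat.mod_lt a hd⟩ ⟨b % d, Nat.mod_lt b hd⟩
    ⟨c % d, Nat.mod_lt c hd⟩ (by simpa [Nat.dvd_mod_iff] using habc) ?_
  have := resultant_eq_zero (B := obsLin d u (xPar d x) (a % d) (b % d) (c % d))
    (c := obsConst (xPar d x) (a % d) (b % d) (c % d)) hz (by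
      rw [obsLin, obsConst, EdShift_zero, Algebra.algebraMap_self, RingHom.id_apply]
      -- Subtracting x_{a+b+c} times the quadratic cancels the z² terms.
      linear_combination h0 - xPar d x (a % d + b % d + c % d) * hz)
  simpa [obs, EdShift_zero] using this

end Yokonuma

/-! ### Assembly of both parts -/

open Yokonuma in
theorem mainTheorem2 (d : ℕ) (hd : 1 ≤ d) (u : ℂ) (hu0 : u ≠ 0) (hu1 : u ≠ 1) :
    (∀ (z : ℂ) (x : Fin (d - 1) → ℂ) (tr : YInf d u →ₗ[ℂ] ℂ), IsJuyumayaTrace d u z x tr →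
      (∀ (i : ℕ) (hi : 1 ≤ i), tr (YInf.e d u i) = Ed d x) ∧
      (∀ (i : ℕ) (hi : 1 ≤ i), tr (lin (YInf.g d u i) (YInf.g d u (i + 1))) = 0 ↔
        (u + 1) * z ^ 2 + ((u - 1) * Ed d x + 3) * z + 1 = 0) ∧
      (u ≠ -1 → ((u + 1) * z ^ 2 + ((u - 1) * Ed d x + 3) * z + 1 = 0 ↔
        z = z₁ u (Ed d x) ∨ z = z₂ u (Ed d x))) ∧
      (FactorsThroughYTLInf d u tr →
        (u + 1) * z ^ 2 + ((u - 1) * Ed d x + 3) * z + 1 = 0)) ∧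
    (2 ≤ d → ∃ P : MvPolynomial (Fin (d - 1)) ℂ, P ≠ 0 ∧
      ∀ (z : ℂ) (x : Fin (d - 1) → ℂ) (tr : YInf d u →ₗ[ℂ] ℂ), IsJuyumayaTrace d u z x tr →
        MvPolynomial.eval x P ≠ 0 →
        ¬ FactorsThroughYTLInf d u tr ∧
        (∀ n : ℕ, 3 ≤ n → ¬ FactorsThroughYTL d u n tr) ∧
        ((u + 1) * z ^ 2 + ((u - 1) * Ed d x + 3) * z + 1 = 0 →
          ∀ k₁ k₂ k : ℕ, ¬ (d ∣ k₁ ∧ d ∣ k₂ ∧ d ∣ k) →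
            ∀ w : Y d u 3, w = Y.t d u 3 1 ^ k₁ * Y.t d u 3 2 ^ k₂ * Y.t d u 3 3 ^ k →
              tr (Y.toInf d u 3 (w * (Y.g d u 3 1 * Y.g d u 3 2 * Y.g d u 3 1))) ≠
                tr (Y.toInf d u 3 (w * (- (Y.g d u 3 1 * Y.g d u 3 2)
                  - Y.g d u 3 2 * Y.g d u 3 1 - Y.g d u 3 1 - Y.g d u 3 2 - 1))))) := by
  refine ⟨fun z x tr h => ⟨h.tr_e hd, fun i hi => by rw [h.tr_lin hd], fun hu =>
    quadratic_iff hu z _, fun hf => ?_⟩, fun hd₂ => ⟨genericPoly d u,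
    genericPoly_ne_zero hd₂ hu1, fun z x tr h hx => ?_⟩⟩
  · have := (hf.factorsThroughYTL 3).tr_mul_lin le_rfl (one_mem _)
    rwa [one_mul, h.tr_lin hd 1 le_rfl] at this
  · have notFactors : ∀ n : ℕ, 3 ≤ n → ¬ FactorsThroughYTL d u n tr := by
      intro n hn hf
      -- Here z is arbitrary: killing L_1 forces the quadratic, and then the trace of t_1 L_1 is
      -- nonzero, because d ≥ 2 does not divide 1.
      have hz := hf.tr_mul_lin hn (one_mem _)
      rw [one_mul, h.tr_lin hd 1 le_rfl] at hz
      refine h.tr_ttt_lin_ne_zero hd hx hz (a := 1) (b := 0) (c := 0)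
        (fun h1 => by have := Nat.le_of_dvd one_pos h1.1; omega) ?_
      simpa using hf.tr_mul_lin hn (YInf.t_mem le_rfl (by omega))
    refine ⟨fun hf => notFactors 3 le_rfl (hf.factorsThroughYTL 3), notFactors, ?_⟩
    rintro hz a b c habc w rfl heq
    refine h.tr_ttt_lin_ne_zero hd hx hz habc ?_
    simp only [map_mul, map_pow, map_sub, map_neg, map_one, Y.toInf_t, Y.toInf_g] at heq
    rw [mul_lin, map_sub, heq, sub_self]
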